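/- Let $B\subseteq A$ be division rings. For a division ring $C$ with $B\subseteq C\subseteq A$, let $\mathrm{End}({}_CA)$ be the ring of endomorphisms of the left $C$-vector space $A$, with product the opposite of the composition. It is an $A$-ring (a ring with a ring homomorphism from $A$) via $a\mapsto r_a$, where $r_a(x)=xa$. An isomorphism of $A$-rings is a ring isomorphism compatible with the homomorphisms from $A$. An $A$-subring of $\mathrm{End}({}_BA)$ is a subring $U$ containing all $r_a$, $a\in A$. It is a right $A$-vector space $U_A$ by $(u\cdot a)(x)=u(x)a$, and $A$ is a right $U$-module $A_U$ by $x\cdot u=u(x)$. The maps $$\mathcal{J}^*(C)=\mathrm{End}({}_CA)\subseteq\mathrm{End}({}_BA),\qquad \mathcal{R}^*(U)=\mathrm{End}(A_U)=\{c\in A : u(ca)=c\,u(a)\ \text{for all } u\in U,\ a\in A\}$$ are mutually inverse bijections between the set of intermediate division rings $B\subseteq C\subseteq A$ such that ${}_CA$ is finite dimensional and the set of $A$-subrings $U\subseteq\mathrm{End}({}_BA)$ such that $U_A$ is finite dimensional. Moreover, two intermediate division rings $B\subseteq C,C'\subseteq A$ are conjugated in $A$ (that is, $C'=gCg^{-1}$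 for some unit $g$ of $A$) if and only if $\mathrm{End}({}_CA)$ and $\mathrm{End}({}_{C'}A)$ are isomorphic as $A$-rings. -/

import Mathlib

namespace JacobsonBourbaki

/-! ### Rings under `A`

An `A`-ring is a ring homomorphism `ι : A →+* E`. -/

section ARing

variable {A : Type*} [Ring A]

/-- The right `A`-module structure `u · a = u * ι a` of an `A`-ring `ι : A →+* E`
(right `A`-modules are modules over `Aᵐᵒᵖ`). -/
abbrev rightModule {E : Type*} [Ring E] (ι : A →+* E) : Module Aᵐᵒᵖ E :=
  Module.compHom E (RingHom.op ι)

/-- The `A`-rings `ι` and `ι'` are isomorphic: there is a ring isomorphism compatible with the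
structure maps from `A`. -/
def ARingIso {E E' : Type*} [Ring E] [Ring E'] (ι : A →+* E) (ι' : A →+* E') : Prop :=
  ∃ e : E ≃+* E', ∀ a : A, e (ι a) = ι' a

/-- An `A`-subring of the `A`-ring `ι : A →+* E`, represented by its inclusion: a subring of `E`
that contains the image of `A`. -/
abbrev ASubring {E : Type*} [Ring E] (ι : A →+* E) : Type _ :=
  {U : Subring E // ι.range ≤ U}

/-- The structure map of an `A`-subring `U`, which makes `U` an `A`-ring. -/
def ASubring.structureMap {E : Type*} [Ring E] {ι : A →+* E} (U : ASubring ι) : A →+* U.1 :=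
  ι.codRestrict U.1 fun a => U.2 (ι.mem_range_self a)

end ARing

section DivisionRings

variable {A : Type*} [DivisionRing A]

/-- `U_A` is finite dimensional, for the right `A`-vector space structure `u · a = u * ι a`. -/
def RightFinite {E : Type*} [Ring E] (ι : A →+* E) : Prop :=
  @FiniteDimensional Aᵐᵒᵖ E _ _ (rightModule ι)

/-- The ring `End(_C A)` of endomorphisms of the left `C`-vector space `A`; its product is the
opposite of the composition. -/
abbrev LEnd (C : Subfield A) : Type _ := (Module.End C A)ᵐᵒᵖ

/-- The `A`-ring structure of `End(_C A)`: `a` is sent to the right multiplication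
`x ↦ x * a`. -/
def rightMul (C : Subfield A) : A →+* LEnd C where
  toFun a := MulOpposite.op
    { toFun := fun x => x * a
      map_add' := fun x y => add_mul x y a
      map_smul' := fun c x => mul_assoc (c : A) x a }
  map_one' := by
    apply MulOpposite.unop_injective
    ext x
    exact mul_one x
  map_mul' a b := by
    apply MulOpposite.unop_injective
    ext x
    exact (mul_assoc x a b).symm
  map_zero' := by
    apply MulOpposite.unop_injective
    ext x
    exact mul_zero x
  map_add' a b := by
    apply MulOpposite.unop_injective
    ext x
    exact mul_add x a b

@[simp] theorem unop_rightMul_apply (C : Subfield A) (a x : A) :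
    (rightMul C a).unop x = x * a := rfl

/-- For `B ≤ C`, the inclusion `End(_C A) → End(_B A)`: a `C`-linear map is `B`-linear. -/
def lendInclusion {B C : Subfield A} (h : B ≤ C) : LEnd C →+* LEnd B where
  toFun u := MulOpposite.op
    { toFun := fun x => u.unop x
      map_add' := fun x y => map_add u.unop x y
      map_smul' := fun b x => map_smul u.unop (⟨b, h b.2⟩ : C) x }
  map_one' := rfl
  map_mul' _ _ := rfl
  map_zero' := rfl
  map_add' _ _ := rfl

@[simp] theorem unop_lendInclusion_apply {B C : Subfield A} (h : B ≤ C) (u : LEnd C) (x : A) :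
    (lendInclusion h u).unop x = u.unop x := rfl

/-- The intermediate division rings `B ⊆ C ⊆ A`. -/
abbrev Intermediate (B : Subfield A) : Type _ := {C : Subfield A // B ≤ C}

/-- The map `C ↦ End(_C A)`, seen as an `A`-subring of `End(_B A)`. -/
def JStar {B : Subfield A} (C : Intermediate B) : ASubring (rightMul B) :=
  ⟨(lendInclusion C.2).range, by
    rintro _ ⟨a, rfl⟩
    exact ⟨rightMul C.1 a, rfl⟩⟩

/-- The map `U ↦ End(A_U)`, where `A` is a right `U`-module by `x · u = u(x)`. An endomorphism of
`A_U` is in particular right `A`-linear, hence the left multiplication by an element `c` of `A`,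
and `End(A_U)` is thereby the subring of all `c` with `u(c x) = c u(x)`. -/
def RStar {B : Subfield A} (U : ASubring (rightMul B)) : Intermediate B :=
  ⟨{  carrier := {c | ∀ u ∈ U.1, ∀ x : A, u.unop (c * x) = c * u.unop x}
      mul_mem' := by
        intro c d hc hd u hu x
        rw [mul_assoc, hc u hu, hd u hu, mul_assoc]
      one_mem' := by
        intro u _ x
        rw [one_mul, one_mul]
      add_mem' := by
        intro c d hc hd u hu x
        rw [add_mul, map_add, hc u hu, hd u hu, add_mul]
      zero_mem' := by
        intro u _ x
        rw [zero_mul, zero_mul, map_zero]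
      neg_mem' := by
        intro c hc u hu x
        rw [neg_mul, map_neg, hc u hu, neg_mul]
      inv_mem' := by
        intro c hc u hu x
        rcases eq_or_ne c 0 with rfl | h
        · rw [inv_zero, zero_mul, zero_mul, map_zero]
        · rw [eq_inv_mul_iff_mul_eq₀ h, ← hc u hu, mul_inv_cancel_left₀ h] },
    fun b hb u _ x => map_smul u.unop (⟨b, hb⟩ : B) x⟩

/-- The set of intermediate division rings `C` with `_C A` finite dimensional. -/
def finiteIntermediate (B : Subfield A) : Set (Intermediate B) :=
  {C | FiniteDimensional C.1 A}

/-- The set of `A`-subrings `U` of `End(_B A)` with `U_A` finite dimensional. -/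
def finiteASubrings (B : Subfield A) : Set (ASubring (rightMul B)) :=
  {U | RightFinite U.structureMap}

/-- `C` and `C'` are conjugated in `A`: `C' = g C g⁻¹` for a unit `g` of `A`. -/
def Conjugated (C C' : Subfield A) : Prop :=
  ∃ g : Aˣ, (C' : Set A) = (fun c : A => (g : A) * c * ((g⁻¹ : Aˣ) : A)) '' (C : Set A)

end DivisionRings

end JacobsonBourbaki

namespace JacobsonBourbaki

/-! Right multiplications make `A` a simple `U`-module whose endomorphisms are the left
multiplications by `RStar U`. Jacobson density then makes `U` dense in the `RStar U`-linear maps,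
and density becomes equality once `A` has a finite basis over `RStar U`; dual systems in `U` bound
that dimension by the dimension of `U_A`. Conversely `C` is its own double centralizer
(`mem_of_forall_commute`). For conjugacy, any `A`-ring isomorphism is conjugation by a left
multiplication (`exists_intertwiner`), and the double centralizer carries `C` to `C'`. -/

theorem exists_linearMap_apply_eq {K V W ι : Type*} [DivisionRing K] [AddCommGroup V] [Module K V]
    [AddCommGroup W] [Module K W] {v : ι → V} (hv : LinearIndependent K v) (f : ι → W) :
    ∃ φ : V →ₗ[K] W, ∀ i, φ (v i) = f i := by
  obtain ⟨g, hg⟩ := LinearMap.exists_leftInverse_of_injective (Finsupp.linearCombination K v)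
    (LinearMap.ker_eq_bot.2 hv)
  refine ⟨Finsupp.linearCombination K f ∘ₗ g, fun i => ?_⟩
  have h := LinearMap.congr_fun hg (Finsupp.single i 1)
  simp only [LinearMap.comp_apply, Finsupp.linearCombination_single, one_smul,
    LinearMap.id_apply] at h
  simp [h]

variable {A : Type*} [DivisionRing A]

/-- The double centralizer property of a division subring: left multiplication by `c` commutes
with all `C`-linear endomorphisms only if `c ∈ C`. -/
theorem mem_of_forall_commute {C : Subfield A} {c : A}
    (h : ∀ (u : LEnd C) (x : A), u.unop (c * x) = c * u.unop x) : c ∈ C := by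
  by_contra hc
  have hli : LinearIndependent C ![(1 : A), c] := by
    rw [LinearIndependent.pair_iff' one_ne_zero]
    rintro ⟨d, hd⟩ hdc
    refine hc ?_
    rw [← hdc]
    change d * 1 ∈ C
    rwa [mul_one]
  -- A map killing `1` but not `c` cannot commute with left multiplication by `c`.
  obtain ⟨φ, hφ⟩ := exists_linearMap_apply_eq hli ![(0 : A), 1]
  have h0 : φ 1 = 0 := hφ 0
  have h1 : φ c = 1 := hφ 1
  have h2 : φ (c * 1) = c * φ 1 := h (MulOpposite.op φ) 1
  rw [mul_one, h1, h0, mul_zero] at h2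
  exact one_ne_zero h2

theorem RStar_JStar {B : Subfield A} (C : Intermediate B) : RStar (JStar C) = C := by
  apply Subtype.ext
  ext c
  constructor
  · intro h
    exact mem_of_forall_commute fun u x => h (lendInclusion C.2 u) ⟨u, rfl⟩ x
  · rintro hc _ ⟨u, rfl⟩ x
    exact map_smul u.unop (⟨c, hc⟩ : C.1) x

instance : Module.Finite Aᵐᵒᵖ A := by
  refine ⟨⟨{1}, ?_⟩⟩
  rw [eq_top_iff, Finset.coe_singleton]
  exact fun x _ => Submodule.mem_span_singleton.2 ⟨MulOpposite.op x, one_mul x⟩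

/-- Evaluation on a finite `C`-basis embeds the endomorphisms right `A`-linearly into `A ^ n`. -/
theorem rightFinite_JStar {B : Subfield A} (C : Intermediate B) [FiniteDimensional C.1 A] :
    RightFinite (JStar C).structureMap := by
  let _ := rightModule (JStar C).structureMap
  let b := Module.finBasis C.1 A
  let f : (JStar C).1 →ₗ[Aᵐᵒᵖ] (Fin (Module.finrank C.1 A) → A) :=
    { toFun := fun u i => u.1.unop (b i)
      map_add' := fun _ _ => rfl
      map_smul' := fun _ _ => rfl }
  refine FiniteDimensional.of_injective f ?_
  rintro ⟨_, u, rfl⟩ ⟨_, v, rfl⟩ huv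
  have : u.unop = v.unop := b.ext fun i => congrFun huv i
  rw [MulOpposite.unop_injective this]

/-- The density theorem for the right `U`-module `A`. -/
theorem exists_mem_eqOn_finset {B : Subfield A} (U : ASubring (rightMul B))
    (u : LEnd (RStar U).1) (s : Finset A) :
    ∃ w ∈ U.1, ∀ x ∈ s, w.unop x = u.unop x := by
  -- Density is stated for left modules, so `U` is replaced by its opposite, acting by application.
  let R : Subring (Module.End B A) := U.1.unop
  have hmul (a : A) : (rightMul B a).unop ∈ R := U.2 ⟨a, rfl⟩
  have : IsSimpleModule R A := by
    rw [isSimpleModule_iff_toSpanSingleton_surjective]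
    refine ⟨inferInstance, fun x hx y => ⟨⟨_, hmul (x⁻¹ * y)⟩, ?_⟩⟩
    exact mul_inv_cancel_left₀ hx y
  -- Commuting with right multiplications forces `φ` to be left multiplication by `φ 1`.
  have hR (φ : Module.End R A) : φ 1 ∈ (RStar U).1 ∧ ∀ x, φ x = φ 1 * x := by
    have h (x : A) : φ x = φ 1 * x := by
      have := φ.map_smul ⟨_, hmul x⟩ 1
      change φ (1 * x) = φ 1 * x at this
      rwa [one_mul] at this
    refine ⟨fun w hw x => ?_, h⟩
    rw [← h, ← h]
    exact (φ.map_smul (⟨w.unop, hw⟩ : R) x).symm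
  let f : Module.End (Module.End R A) A :=
    { toFun := fun x => u.unop x
      map_add' := fun x y => map_add u.unop x y
      map_smul' := fun φ x => by
        change u.unop (φ x) = φ (u.unop x)
        rw [(hR φ).2, (hR φ).2 (u.unop x)]
        exact map_smul u.unop (⟨φ 1, (hR φ).1⟩ : (RStar U).1) x }
  obtain ⟨r, hr⟩ := jacobson_density (R := R) f s
  exact ⟨MulOpposite.op r.1, r.2, fun x hx => (hr x hx).symm⟩

open Classical in
-- Density yields, for each finite independent `s`, elements of `U` dual to `s`. Evaluating at the
-- points of `s` shows them right `A`-independent, so `s` has at most `dim U_A` elements.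
theorem finiteDimensional_RStar {B : Subfield A} (U : ASubring (rightMul B))
    (hU : RightFinite U.structureMap) : FiniteDimensional (RStar U).1 A := by
  let _ := rightModule U.structureMap
  have : FiniteDimensional Aᵐᵒᵖ U.1 := hU
  have hrank : Module.rank (RStar U).1 A ≤ Module.finrank Aᵐᵒᵖ U.1 := by
    refine rank_le fun s hs => ?_
    have hex (i : s) : ∃ w : U.1, ∀ j : s, w.1.unop j = if j = i then (1 : A) else 0 := by
      obtain ⟨φ, hφ⟩ := exists_linearMap_apply_eq hs fun j => if j = i then (1 : A) else 0
      obtain ⟨w, hw, hws⟩ := exists_mem_eqOn_finset U (MulOpposite.op φ) s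
      exact ⟨⟨w, hw⟩, fun j => (hws j j.2).trans (hφ j)⟩
    choose w hw using hex
    have hli : LinearIndependent Aᵐᵒᵖ w := by
      rw [Fintype.linearIndependent_iff]
      intro a ha j
      let ev : U.1 →ₗ[Aᵐᵒᵖ] A :=
        { toFun := fun u => u.1.unop j
          map_add' := fun _ _ => rfl
          map_smul' := fun _ _ => rfl }
      have h : ev (∑ i, a i • w i) = 0 := by rw [ha, map_zero]
      have hev (i : s) : ev (w i) = if j = i then 1 else 0 := hw i j
      simpa [hev] using h
    simpa using hli.fintype_card_le_finrank
  exact Module.rank_lt_aleph0_iff.1 (hrank.trans_lt (Cardinal.natCast_lt_aleph0))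

open Classical in
theorem JStar_RStar {B : Subfield A} (U : ASubring (rightMul B))
    (hU : RightFinite U.structureMap) : JStar (RStar U) = U := by
  have := finiteDimensional_RStar U hU
  apply Subtype.ext
  ext w
  constructor
  · rintro ⟨u, rfl⟩
    let b := Module.finBasis (RStar U).1 A
    -- Elements of `U` are `RStar U`-linear, so agreement on the basis is equality.
    obtain ⟨v, hv, hvu⟩ := exists_mem_eqOn_finset U u (Finset.univ.image b)
    let v' : LEnd (RStar U).1 := MulOpposite.op
      { toFun := fun x => v.unop x
        map_add' := fun x y => map_add v.unop x y
        map_smul' := fun c x => c.2 v hv x }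
    have h : v'.unop = u.unop :=
      b.ext fun i => hvu _ (Finset.mem_image_of_mem b (Finset.mem_univ i))
    rw [← MulOpposite.unop_injective h]
    exact hv
  · intro hw
    exact ⟨MulOpposite.op
      { toFun := fun x => w.unop x
        map_add' := fun x y => map_add w.unop x y
        map_smul' := fun c x => c.2 w hw x }, rfl⟩

/-- Conjugation by left multiplication with `g`, for `g⁻¹ C' g ⊆ C`. -/
def conjHom {C C' : Subfield A} (g : A) (hg : g ≠ 0) (h : ∀ c ∈ C', g⁻¹ * c * g ∈ C) :
    LEnd C →+* LEnd C' where
  toFun u := MulOpposite.op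
    { toFun := fun x => g * u.unop (g⁻¹ * x)
      map_add' := fun x y => by rw [mul_add, map_add, mul_add]
      map_smul' := fun c x => by
        have hc : u.unop (g⁻¹ * c * g * (g⁻¹ * x)) = g⁻¹ * c * g * u.unop (g⁻¹ * x) :=
          map_smul u.unop (⟨_, h c c.2⟩ : C) _
        change g * u.unop (g⁻¹ * (c * x)) = c * (g * u.unop (g⁻¹ * x))
        rw [mul_assoc (g⁻¹ * (c : A)), mul_inv_cancel_left₀ hg, mul_assoc] at hc
        rw [hc]
        simp only [mul_assoc, mul_inv_cancel_left₀ hg] }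
  map_one' := MulOpposite.unop_injective <| LinearMap.ext fun x => mul_inv_cancel_left₀ hg x
  map_mul' u v := MulOpposite.unop_injective <| LinearMap.ext fun x => by
    change g * v.unop (u.unop (g⁻¹ * x)) = g * v.unop (g⁻¹ * (g * u.unop (g⁻¹ * x)))
    rw [inv_mul_cancel_left₀ hg]
  map_zero' := MulOpposite.unop_injective <| LinearMap.ext fun _ => mul_zero g
  map_add' u v := MulOpposite.unop_injective <| LinearMap.ext fun _ => mul_add g _ _

theorem aRingIso_of_conjugated {C C' : Subfield A} (h : Conjugated C C') :
    ARingIso (rightMul C) (rightMul C') := by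
  obtain ⟨g, hg⟩ := h
  have hg0 : (g : A) ≠ 0 := g.ne_zero
  have h1 : ∀ c ∈ C', (g : A)⁻¹ * c * g ∈ C := by
    intro c hc
    obtain ⟨d, hd, rfl⟩ : c ∈ (fun c : A => (g : A) * c * ((g⁻¹ : Aˣ) : A)) '' (C : Set A) :=
      hg ▸ hc
    simpa [mul_assoc] using hd
  have h2 : ∀ c ∈ C, ((g : A)⁻¹)⁻¹ * c * (g : A)⁻¹ ∈ C' := by
    intro c hc
    have : (g : A) * c * ((g⁻¹ : Aˣ) : A) ∈ (C' : Set A) := hg ▸ ⟨c, hc, rfl⟩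
    simpa using this
  refine ⟨RingEquiv.ofRingHom (conjHom _ hg0 h1) (conjHom _ (inv_ne_zero hg0) h2) ?_ ?_, ?_⟩
  · ext u
    refine MulOpposite.unop_injective (LinearMap.ext fun x => ?_)
    change (g : A) * ((g : A)⁻¹ * u.unop ((g : A)⁻¹⁻¹ * ((g : A)⁻¹ * x))) = u.unop x
    simp
  · ext u
    refine MulOpposite.unop_injective (LinearMap.ext fun x => ?_)
    change (g : A)⁻¹ * ((g : A) * u.unop ((g : A)⁻¹ * ((g : A)⁻¹⁻¹ * x))) = u.unop x
    simp
  · intro a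
    refine MulOpposite.unop_injective (LinearMap.ext fun x => ?_)
    change (g : A) * ((g : A)⁻¹ * x * a) = x * a
    simp [mul_assoc]

/-- An isomorphism of `A`-rings `End(_C A) ≃ End(_C' A)` is implemented by the left multiplication
by a nonzero element of `A`. -/
theorem exists_intertwiner {C C' : Subfield A} (e : LEnd C ≃+* LEnd C')
    (he : ∀ a, e (rightMul C a) = rightMul C' a) :
    ∃ g : A, g ≠ 0 ∧ ∀ (u : LEnd C) (x : A), (e u).unop (g * x) = g * u.unop x := by
  have hli : LinearIndependent C ![(1 : A)] := by
    rw [linearIndependent_unique_iff]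
    exact one_ne_zero
  obtain ⟨π, hπ⟩ := exists_linearMap_apply_eq hli ![(1 : C)]
  -- A projection onto the line `C · 1`. In the opposite product `p * u` applies `p` before `u`, so
  -- it depends only on `u 1`.
  let p : LEnd C := MulOpposite.op ((LinearMap.toSpanSingleton C A 1) ∘ₗ π)
  have hp1 : p.unop 1 = 1 := by
    change π 1 • (1 : A) = 1
    rw [show π 1 = 1 from hπ 0, one_smul]
  have hp0 : p ≠ 0 := by
    intro h
    rw [h] at hp1
    exact zero_ne_one hp1
  have hpu {u : LEnd C} (hu : u.unop 1 = 0) : p * u = 0 := by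
    refine MulOpposite.unop_injective (LinearMap.ext fun x => ?_)
    change u.unop (π x • (1 : A)) = 0
    rw [map_smul, hu, smul_zero]
  have hep : (e p).unop ≠ 0 := by
    intro h
    exact hp0 (e.map_eq_zero_iff.1 (MulOpposite.unop_injective h))
  obtain ⟨y, hy⟩ := DFunLike.ne_iff.1 hep
  have key (u : LEnd C) : (e u).unop ((e p).unop y) = (e p).unop y * u.unop 1 := by
    -- `u` and right multiplication by `u 1` agree at `1`; `e` fixes the latter, which transports
    -- the relation to `C'`.
    have h0 : p * (u - rightMul C (u.unop 1)) = 0 := by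
      apply hpu
      change u.unop 1 - 1 * u.unop 1 = 0
      rw [one_mul, sub_self]
    have h1 := congrArg e h0
    rw [map_mul, map_sub, he, map_zero] at h1
    have h2 : (e u).unop ((e p).unop y) - (e p).unop y * u.unop 1 = 0 :=
      LinearMap.congr_fun (congrArg MulOpposite.unop h1) y
    exact sub_eq_zero.1 h2
  refine ⟨(e p).unop y, hy, fun u x => ?_⟩
  -- Precomposing with right multiplication by `x` moves the evaluation point from `1` to `x`.
  have h := key (rightMul C x * u)
  rw [map_mul, he] at h
  change (e u).unop ((e p).unop y * x) = (e p).unop y * u.unop (1 * x) at h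
  rwa [one_mul] at h

theorem conjugated_of_aRingIso {C C' : Subfield A} (h : ARingIso (rightMul C) (rightMul C')) :
    Conjugated C C' := by
  obtain ⟨e, he⟩ := h
  obtain ⟨g, hg, hgu⟩ := exists_intertwiner e he
  refine ⟨Units.mk0 g hg, Set.Subset.antisymm ?_ ?_⟩
  · intro c hc
    refine ⟨g⁻¹ * c * g, mem_of_forall_commute fun u x => ?_, ?_⟩
    · have hl : (e u).unop (c * (g * x)) = c * (e u).unop (g * x) :=
        map_smul (e u).unop (⟨c, hc⟩ : C') _
      have h2 := hgu u (g⁻¹ * c * g * x)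
      simp only [mul_assoc, mul_inv_cancel_left₀ hg] at h2
      rw [hl, hgu] at h2
      simp only [mul_assoc]
      rw [h2, inv_mul_cancel_left₀ hg]
    · simp [mul_assoc, hg]
  · rintro _ ⟨c, hc, rfl⟩
    refine mem_of_forall_commute fun v x => ?_
    -- Surjectivity of `e` reduces the test against all `C'`-linear maps to those intertwined by
    -- `g`.
    obtain ⟨u, rfl⟩ := e.surjective v
    have hl (z : A) : u.unop (c * z) = c * u.unop z := map_smul u.unop (⟨c, hc⟩ : C) z
    have h2 := hgu u (g⁻¹ * x)
    rw [mul_inv_cancel_left₀ hg] at h2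
    simp only [Units.val_inv_eq_inv_val, Units.val_mk0, mul_assoc]
    rw [hgu, hl, h2, inv_mul_cancel_left₀ hg]

end JacobsonBourbaki

theorem mainTheorem7 {A : Type*} [DivisionRing A] (B : Subfield A) :
    (Set.BijOn JacobsonBourbaki.JStar
        (JacobsonBourbaki.finiteIntermediate B) (JacobsonBourbaki.finiteASubrings B) ∧
      Set.BijOn JacobsonBourbaki.RStar
        (JacobsonBourbaki.finiteASubrings B) (JacobsonBourbaki.finiteIntermediate B) ∧
      Set.InvOn JacobsonBourbaki.RStar JacobsonBourbaki.JStar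
        (JacobsonBourbaki.finiteIntermediate B) (JacobsonBourbaki.finiteASubrings B)) ∧
    ∀ C C' : Subfield A, B ≤ C → B ≤ C' →
      (JacobsonBourbaki.Conjugated C C' ↔
        JacobsonBourbaki.ARingIso
          (JacobsonBourbaki.rightMul C) (JacobsonBourbaki.rightMul C')) := by
  have hJ : Set.MapsTo JacobsonBourbaki.JStar
      (JacobsonBourbaki.finiteIntermediate B) (JacobsonBourbaki.finiteASubrings B) := fun C hC =>
    have : FiniteDimensional C.1 A := hC
    JacobsonBourbaki.rightFinite_JStar C
  have hR : Set.MapsTo JacobsonBourbaki.RStar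
      (JacobsonBourbaki.finiteASubrings B) (JacobsonBourbaki.finiteIntermediate B) :=
    fun U hU => JacobsonBourbaki.finiteDimensional_RStar U hU
  have hinv : Set.InvOn JacobsonBourbaki.RStar JacobsonBourbaki.JStar
      (JacobsonBourbaki.finiteIntermediate B) (JacobsonBourbaki.finiteASubrings B) :=
    ⟨fun C _ => JacobsonBourbaki.RStar_JStar C, fun U hU => JacobsonBourbaki.JStar_RStar U hU⟩
  exact ⟨⟨hinv.bijOn hJ hR, hinv.symm.bijOn hR hJ, hinv⟩, fun C C' _ _ =>
    ⟨JacobsonBourbaki.aRingIso_of_conjugated, JacobsonBourbaki.conjugated_of_aRingIso⟩⟩
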